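/- A *Banach lattice algebra* is a real Banach lattice $X$ equipped with an associative bilinear product for which the norm is submultiplicative and $ab\ge 0$ whenever $a,b\ge 0$. It is an *AM-algebra* if there is a net $(e_\alpha)$ of positive elements of $X$ such that $x^*(e_\alpha)\to\|x^*\|$ for every positive $x^*\in X^*$, and $e_\alpha a\to a$ and $ae_\alpha\to a$ in norm for every $a\in X$. Let $X$ be an AM-algebra. Then: 1. Every norm-closed subalgebra of $X$ (a linear subspace closed under the product, not required to contain a unit) is a closed sublattice of $X$, i.e. it is also closed under $\vee$ and $\wedge$. 2. A norm-closed linear subspace $J\subseteq X$ is an algebraic ideal (that is, $ax\in J$ and $xa\in J$ for all $a\in X$, $x\in J$) if and only if it is an order ideal (that is, $x\in J$, $y\in X$ and $|y|\le|x|$ imply $y\in J$). -/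

import Mathlib

open Filter Topology

universe u v

section AMAlgebra

/-- A net `e` in a Banach lattice `X` is an approximate order unit if it consists of positive
elements and `φ (e i) → ‖φ‖` for every positive functional `φ` in the norm dual of `X`. -/
structure IsApproximateOrderUnit {X : Type*} [NormedAddCommGroup X] [NormedSpace ℝ X] [Lattice X]
    {ι : Type*} [Preorder ι] (e : ι → X) : Prop where
  nonneg : ∀ i, 0 ≤ e i
  tendsto_norm : ∀ φ : StrongDual ℝ X, (∀ x : X, 0 ≤ x → 0 ≤ φ x) →
    Tendsto (fun i => φ (e i)) atTop (𝓝 ‖φ‖)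

/-- A net `e` in a Banach algebra `A` is an approximate (algebraic) identity if
`e i * a → a` and `a * e i → a` in norm, for every `a`. -/
structure IsApproximateIdentity {A : Type*} [NonUnitalNormedRing A]
    {ι : Type*} [Preorder ι] (e : ι → A) : Prop where
  tendsto_left : ∀ a : A, Tendsto (fun i => e i * a) atTop (𝓝 a)
  tendsto_right : ∀ a : A, Tendsto (fun i => a * e i) atTop (𝓝 a)

/-- A Banach lattice algebra `A` is an AM-algebra (and its product is the AM-algebra product) if
some net, indexed by a nonempty directed set, is both an approximate order unit and an approximate
identity. The universe `v` of the index set is arbitrary. -/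
def IsAMAlgebra (A : Type u) [NonUnitalNormedRing A] [NormedSpace ℝ A] [Lattice A] : Prop :=
  ∃ (ι : Type v) (_ : Preorder ι) (_ : IsDirectedOrder ι) (_ : Nonempty ι) (e : ι → A),
    IsApproximateOrderUnit e ∧ IsApproximateIdentity e

/-- A linear subspace is an algebraic ideal if it absorbs products on both sides. -/
def IsAlgebraicIdeal {A : Type*} [NonUnitalNormedRing A] [NormedSpace ℝ A]
    (J : Submodule ℝ A) : Prop :=
  ∀ a : A, ∀ x ∈ J, a * x ∈ J ∧ x * a ∈ J

/-- A linear subspace is an order ideal if it is solid: `x ∈ J` and `|y| ≤ |x|` imply `y ∈ J`. -/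
def IsOrderIdeal {X : Type*} [NormedAddCommGroup X] [NormedSpace ℝ X] [Lattice X]
    (J : Submodule ℝ X) : Prop :=
  ∀ x ∈ J, ∀ y : X, |y| ≤ |x| → y ∈ J

end AMAlgebra

/-! For positive `φ` and `b ≥ 0`, the functional `a ↦ φ (a * b)` is positive, and the net shows its
norm to be `φ b`. Hence `a * b ≤ ‖a‖ • b`, and likewise on the other side: multiplications are
central operators (`mul_le_norm_smul`). The net also bounds `‖z‖` by any `c ≥ 0` with `b * z ≤ c •
b` for all `b ≥ 0`, so elementary estimates on the unit interval become norm estimates.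

Centrality makes products of disjoint elements vanish, so `|x|² = x²` and `|x|` is a limit of
polynomials in `x²` without constant term: closed subalgebras are sublattices. Order ideals absorb
products since `|a * x| ≤ ‖a‖ • |x|`. Conversely, if `0 ≤ y ≤ x ∈ J` and `v = x / ‖x‖`, then `y (1 -
v) ^ n` stays in `y + J` and tends to `0`, so `y ∈ J`. -/

section PositiveFunctionals

section SMul

variable {X : Type*} [AddCommGroup X] [Lattice X] [Module ℝ X] [IsOrderedModule ℝ X]

theorem posPart_smul_of_pos {c : ℝ} (hc : 0 < c) (x : X) : (c • x)⁺ = c • x⁺ := by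
  have h : c • (x ⊔ 0) = c • x ⊔ c • (0 : X) := (OrderIso.smulRight (β := X) hc).map_sup x 0
  rw [smul_zero] at h
  exact h.symm

theorem abs_smul_of_pos {c : ℝ} (hc : 0 < c) (x : X) : |c • x| = c • |x| := by
  have h : c • (x ⊔ -x) = c • x ⊔ c • (-x) := (OrderIso.smulRight (β := X) hc).map_sup x (-x)
  rw [smul_neg] at h
  exact h.symm

end SMul

variable {X : Type*} [NormedAddCommGroup X] [Lattice X] [IsOrderedAddMonoid X]

theorem norm_le_norm_of_nonneg_of_le [HasSolidNorm X] {x y : X} (hx : 0 ≤ x) (hxy : x ≤ y) :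
    ‖x‖ ≤ ‖y‖ :=
  norm_le_norm_of_abs_le_abs (by rwa [abs_of_nonneg hx, abs_of_nonneg (hx.trans hxy)])

theorem norm_posPart_le_norm [HasSolidNorm X] (x : X) : ‖x⁺‖ ≤ ‖x‖ := by
  have h := norm_le_norm_of_nonneg_of_le (posPart_nonneg x) (sup_le (le_abs_self x) (abs_nonneg x))
  rwa [norm_abs_eq_norm] at h

theorem posPart_add_le_posPart_add (x y : X) : (x + y)⁺ ≤ x⁺ + y⁺ :=
  sup_le (add_le_add (le_posPart x) (le_posPart y))
    (add_nonneg (posPart_nonneg x) (posPart_nonneg y))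

variable [NormedSpace ℝ X] [IsOrderedModule ℝ X] [HasSolidNorm X]

/-- The norm of the positive part of an element is attained at a positive functional of norm at
most one. -/
theorem exists_positive_dual_eq_norm_posPart (z : X) :
    ∃ φ : StrongDual ℝ X, (∀ x, 0 ≤ x → 0 ≤ φ x) ∧ ‖φ‖ ≤ 1 ∧ φ z = ‖z⁺‖ := by
  by_cases hz : z = 0
  · exact ⟨0, by simp, by simp, by simp [hz]⟩
  let f : X →ₗ.[ℝ] ℝ := LinearPMap.mkSpanSingleton z ‖z⁺‖ hz
  obtain ⟨g, hgf, hg⟩ := exists_extension_of_le_sublinear f (fun x => ‖x⁺‖)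
    (fun c hc x => by
      simp only [posPart_smul_of_pos hc, norm_smul, Real.norm_of_nonneg hc.le])
    (fun x y => (norm_le_norm_of_nonneg_of_le (posPart_nonneg _)
      (posPart_add_le_posPart_add x y)).trans (norm_add_le _ _))
    (by
      rintro ⟨x, hx⟩
      obtain ⟨t, rfl⟩ := Submodule.mem_span_singleton.1 hx
      rw [LinearPMap.mkSpanSingleton'_apply]
      rcases le_or_gt t 0 with ht | ht
      · exact (mul_nonpos_of_nonpos_of_nonneg ht (norm_nonneg _)).trans (norm_nonneg _)
      · simp [posPart_smul_of_pos ht, norm_smul, abs_of_pos ht])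
  have hpos : ∀ x, 0 ≤ x → 0 ≤ g x := fun x hx => by
    have h := hg (-x)
    rw [posPart_eq_zero.2 (neg_nonpos.2 hx), norm_zero, map_neg] at h
    linarith
  have hbound : ∀ x, ‖g x‖ ≤ 1 * ‖x‖ := fun x => by
    have h₁ := (hg x).trans (norm_posPart_le_norm x)
    have h₂ := (hg (-x)).trans (norm_posPart_le_norm (-x))
    rw [map_neg, norm_neg] at h₂
    rw [one_mul, Real.norm_eq_abs, abs_le]
    constructor <;> linarith
  refine ⟨g.mkContinuous 1 hbound, hpos, g.mkContinuous_norm_le zero_le_one hbound, ?_⟩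
  have hz' := hgf ⟨z, Submodule.mem_span_singleton_self z⟩
  rw [LinearMap.mkContinuous_apply, hz']
  exact LinearPMap.mkSpanSingleton_apply ℝ ℝ hz _

theorem le_of_forall_positive_dual {x y : X}
    (h : ∀ φ : StrongDual ℝ X, (∀ x, 0 ≤ x → 0 ≤ φ x) → φ x ≤ φ y) : x ≤ y := by
  obtain ⟨φ, hφ, -, hz⟩ := exists_positive_dual_eq_norm_posPart (x - y)
  have h₁ := h φ hφ
  rw [map_sub] at hz
  have h₂ : ‖(x - y)⁺‖ = 0 := le_antisymm (by linarith) (norm_nonneg _)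
  exact sub_nonpos.1 (posPart_eq_zero.1 (norm_eq_zero.1 h₂))

end PositiveFunctionals

/-! ### Polynomial sequences without a unit -/

/-- The sequence `b (1 - x) ^ n`, written without a unit. -/
def mulOneSubPow {A : Type*} [NonUnitalRing A] (x b : A) : ℕ → A
  | 0 => b
  | n + 1 => mulOneSubPow x b n - mulOneSubPow x b n * x

theorem mulOneSubPow_sub {A : Type*} [NonUnitalRing A] (x b c : A) (n : ℕ) :
    mulOneSubPow x (b - c) n = mulOneSubPow x b n - mulOneSubPow x c n := by
  induction n with
  | zero => rfl
  | succ n ih =>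
    simp only [mulOneSubPow, ih, sub_mul]
    abel

theorem mulOneSubPow_smul {A : Type*} [NonUnitalRing A] [Module ℝ A] [IsScalarTower ℝ A A] (c : ℝ)
    (x b : A) (n : ℕ) : mulOneSubPow x (c • b) n = c • mulOneSubPow x b n := by
  induction n with
  | zero => rfl
  | succ n ih => simp only [mulOneSubPow, ih, smul_sub, smul_mul_assoc]

theorem mul_mulOneSubPow_self {A : Type*} [NonUnitalRing A] (x b : A) (n : ℕ) :
    b * mulOneSubPow x x n = mulOneSubPow x b n * x := by
  induction n with
  | zero => rfl
  | succ n ih => simp only [mulOneSubPow, mul_sub, sub_mul, ← mul_assoc, ih]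

section AbsApprox

variable {A : Type*} [NonUnitalRing A] [Module ℝ A]

/-- The recursion `u ↦ u + (x ^ 2 - u ^ 2) / 2`, started at `0`, whose iterates are polynomials in
`x ^ 2` without constant term converging to `|x|` when `‖x‖ ≤ 1`. -/
noncomputable def absApprox (x : A) : ℕ → A
  | 0 => 0
  | n + 1 => absApprox x n + (1 / 2 : ℝ) • (x * x - absApprox x n * absApprox x n)

theorem absApprox_mem {x : A} {Y : NonUnitalSubalgebra ℝ A} (hx : x ∈ Y) (n : ℕ) :
    absApprox x n ∈ Y := by
  induction n with
  | zero => exact Y.zero_mem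
  | succ n ih => exact Y.add_mem ih (SMulMemClass.smul_mem _ (Y.sub_mem (Y.mul_mem hx hx) (Y.mul_mem ih ih)))

theorem absApprox_congr {x y : A} (hxy : x * x = y * y) (n : ℕ) :
    absApprox x n = absApprox y n := by
  induction n with
  | zero => rfl
  | succ n ih => rw [absApprox.eq_2, absApprox.eq_2, ih, hxy]

variable [IsScalarTower ℝ A A] [SMulCommClass ℝ A A]

theorem commute_absApprox (x : A) (n : ℕ) :
    Commute x (absApprox x n) := by
  induction n with
  | zero => exact Commute.zero_right x
  | succ n ih =>
    exact ih.add_right ((((Commute.refl x).mul_right (Commute.refl x)).sub_right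
      (ih.mul_right ih)).smul_right _)

/-- Since `z` commutes with the iterate `u`, `z² - u² = (z - u)(z + u)`: each step multiplies the
error by `1 - (z + u) / 2`. -/
theorem sub_absApprox_succ (z : A) (n : ℕ) :
    z - absApprox z (n + 1) = (z - absApprox z n) -
      (z - absApprox z n) * ((1 / 2 : ℝ) • (z + absApprox z n)) := by
  have hc : z * absApprox z n = absApprox z n * z := commute_absApprox z n
  rw [absApprox.eq_2, mul_smul_comm, sub_mul, mul_add, mul_add, hc]
  rw [show ∀ a b c : A, a + b - (b + c) = a - c from fun a b c => by abel]
  abel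

end AbsApprox

/-! ### Consequences of centrality -/

section LatticeAlgebra

variable {A : Type*} [NonUnitalNormedRing A] [NormedSpace ℝ A] [Lattice A] [IsOrderedAddMonoid A]

/-- The two consequences of the AM-algebra axioms on which the structure theory rests: elements act
by multiplication as central operators, and the norm is an operator-type order norm. -/
structure IsCentralNormed (A : Type*) [NonUnitalNormedRing A] [NormedSpace ℝ A] [Lattice A] :
    Prop where
  mul_nonneg : ∀ a b : A, 0 ≤ a → 0 ≤ b → 0 ≤ a * b
  mul_le : ∀ a b : A, 0 ≤ b → a * b ≤ ‖a‖ • b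
  mul_le' : ∀ a b : A, 0 ≤ b → b * a ≤ ‖a‖ • b
  norm_le : ∀ (z : A) (c : ℝ), 0 ≤ z → 0 ≤ c → (∀ b : A, 0 ≤ b → b * z ≤ c • b) → ‖z‖ ≤ c

namespace IsCentralNormed

theorem mul_le_mul_left (h : IsCentralNormed A) {a b c : A} (hc : 0 ≤ c) (hab : a ≤ b) :
    c * a ≤ c * b := by
  have := h.mul_nonneg c (b - a) hc (sub_nonneg.2 hab)
  rwa [mul_sub, sub_nonneg] at this

theorem mul_le_mul_right (h : IsCentralNormed A) {a b c : A} (hc : 0 ≤ c) (hab : a ≤ b) :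
    a * c ≤ b * c := by
  have := h.mul_nonneg (b - a) c (sub_nonneg.2 hab) hc
  rwa [sub_mul, sub_nonneg] at this

theorem abs_mul_le (h : IsCentralNormed A) (x y : A) : |x * y| ≤ |x| * |y| := by
  have h₁ := h.mul_nonneg _ _ (posPart_nonneg x) (posPart_nonneg y)
  have h₂ := h.mul_nonneg _ _ (posPart_nonneg x) (negPart_nonneg y)
  have h₃ := h.mul_nonneg _ _ (negPart_nonneg x) (posPart_nonneg y)
  have h₄ := h.mul_nonneg _ _ (negPart_nonneg x) (negPart_nonneg y)
  have h₅ : x * y = (x⁺ - x⁻) * (y⁺ - y⁻) := by simp only [posPart_sub_negPart]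
  rw [h₅, ← posPart_add_negPart x, ← posPart_add_negPart y]
  refine abs_le'.2 ⟨sub_nonneg.1 ?_, sub_nonneg.1 ?_⟩
  · refine (add_nonneg (add_nonneg h₂ h₂) (add_nonneg h₃ h₃)).trans_eq ?_
    simp only [mul_add, add_mul, mul_sub, sub_mul]
    abel
  · refine (add_nonneg (add_nonneg h₁ h₁) (add_nonneg h₄ h₄)).trans_eq ?_
    simp only [mul_add, add_mul, mul_sub, sub_mul]
    abel

variable [IsOrderedModule ℝ A]

theorem mul_le_self (h : IsCentralNormed A) {a b : A} (hb : 0 ≤ b) (ha : ‖a‖ ≤ 1) :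
    b * a ≤ b :=
  (h.mul_le' a b hb).trans
    ((smul_le_smul_of_nonneg_right ha hb).trans_eq (one_smul ℝ b))

/-- Centrality on both sides puts `a * b` below a common multiple of `a` and of `b`, hence below a
multiple of `a ⊓ b`. -/
theorem mul_eq_zero_of_inf_eq_zero (h : IsCentralNormed A) {a b : A} (hab : a ⊓ b = 0) :
    a * b = 0 := by
  have ha : 0 ≤ a := hab ▸ inf_le_left
  have hb : 0 ≤ b := hab ▸ inf_le_right
  -- The summand `1` keeps the factor positive, so that scaling is an order isomorphism.
  have hM : 0 < ‖a‖ + ‖b‖ + 1 := by positivity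
  have h₁ : a * b ≤ (‖a‖ + ‖b‖ + 1) • b := (h.mul_le a b hb).trans
    (smul_le_smul_of_nonneg_right (by linarith [norm_nonneg b]) hb)
  have h₂ : a * b ≤ (‖a‖ + ‖b‖ + 1) • a := (h.mul_le' b a ha).trans
    (smul_le_smul_of_nonneg_right (by linarith [norm_nonneg a]) ha)
  have h₃ := (OrderIso.smulRight (β := A) hM).map_inf a b
  rw [hab] at h₃
  refine le_antisymm ((le_inf h₂ h₁).trans ?_) (h.mul_nonneg a b ha hb)
  simpa using h₃.ge

theorem abs_mul_abs_self (h : IsCentralNormed A) (x : A) : |x| * |x| = x * x := by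
  have h₁ := h.mul_eq_zero_of_inf_eq_zero (posPart_inf_negPart_eq_zero x)
  have h₂ := h.mul_eq_zero_of_inf_eq_zero
    ((inf_comm _ _).trans (posPart_inf_negPart_eq_zero x))
  have h₃ : x * x = (x⁺ - x⁻) * (x⁺ - x⁻) := by rw [posPart_sub_negPart]
  rw [h₃, ← posPart_add_negPart]
  simp only [mul_add, add_mul, mul_sub, sub_mul, h₁, h₂]
  abel

theorem isAlgebraicIdeal_of_isOrderIdeal [HasSolidNorm A] (h : IsCentralNormed A)
    {J : Submodule ℝ A} (hJ : IsOrderIdeal J) :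
    IsAlgebraicIdeal J := by
  intro a x hx
  rcases eq_or_ne a 0 with rfl | ha
  · simp
  have key : |‖a‖ • x| = ‖a‖ • |x| := abs_smul_of_pos (norm_pos_iff.2 ha) x
  refine ⟨hJ _ (J.smul_mem ‖a‖ hx) _ ?_, hJ _ (J.smul_mem ‖a‖ hx) _ ?_⟩
  · rw [key, ← norm_abs_eq_norm a]
    exact (h.abs_mul_le a x).trans (h.mul_le _ _ (abs_nonneg x))
  · rw [key, ← norm_abs_eq_norm a]
    exact (h.abs_mul_le x a).trans (h.mul_le' _ _ (abs_nonneg x))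

theorem mulOneSubPow_nonneg (h : IsCentralNormed A) {x b : A} (hx : ‖x‖ ≤ 1) (hb : 0 ≤ b) (n : ℕ) :
    0 ≤ mulOneSubPow x b n := by
  induction n with
  | zero => exact hb
  | succ n ih => exact sub_nonneg.2 (h.mul_le_self ih hx)

theorem mulOneSubPow_mono (h : IsCentralNormed A) {x b c : A} (hx : ‖x‖ ≤ 1) (hbc : b ≤ c)
    (n : ℕ) : mulOneSubPow x b n ≤ mulOneSubPow x c n := by
  rw [← sub_nonneg, ← mulOneSubPow_sub]
  exact h.mulOneSubPow_nonneg hx (sub_nonneg.2 hbc) n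

/-- The right side telescopes into the `n + 1` terms `b (1 - x) ^ k x`, `k ≤ n`, which decrease in
`k`; the left side repeats the last one. -/
theorem succ_nsmul_mulOneSubPow_mul_le (h : IsCentralNormed A) {x b : A} (hx₀ : 0 ≤ x)
    (hx : ‖x‖ ≤ 1) (hb : 0 ≤ b) (n : ℕ) :
    (n + 1) • (mulOneSubPow x b n * x) ≤ b - mulOneSubPow x b (n + 1) := by
  induction n with
  | zero => simp [mulOneSubPow]
  | succ n ih =>
    have hstep : mulOneSubPow x b (n + 1) * x ≤ mulOneSubPow x b n * x :=
      h.mul_le_mul_right hx₀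
        (sub_le_self _ (h.mul_nonneg _ _ (h.mulOneSubPow_nonneg hx hb n) hx₀))
    rw [succ_nsmul]
    calc _ ≤ (b - mulOneSubPow x b (n + 1)) + mulOneSubPow x b (n + 1) * x := by
          gcongr
          exact (nsmul_le_nsmul_right hstep _).trans ih
      _ = b - mulOneSubPow x b (n + 1 + 1) := by
          rw [mulOneSubPow.eq_2 x b (n + 1)]
          abel

/-- The elementary estimate `t (1 - t) ^ n ≤ 1 / (n + 1)` on the unit interval. -/
theorem norm_mulOneSubPow_self_le (h : IsCentralNormed A) {x : A} (hx₀ : 0 ≤ x) (hx : ‖x‖ ≤ 1)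
    (n : ℕ) : ‖mulOneSubPow x x n‖ ≤ 1 / ((n : ℝ) + 1) := by
  have hn : (0 : ℝ) < (n : ℝ) + 1 := by positivity
  refine h.norm_le _ _ (h.mulOneSubPow_nonneg hx hx₀ n) (by positivity) fun b hb => ?_
  have h₁ := (h.succ_nsmul_mulOneSubPow_mul_le hx₀ hx hb n).trans
    (sub_le_self _ (h.mulOneSubPow_nonneg hx hb (n + 1)))
  rw [← mul_mulOneSubPow_self, ← Nat.cast_smul_eq_nsmul ℝ] at h₁
  have h₂ := smul_le_smul_of_nonneg_left h₁ (one_div_pos.2 hn).le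
  rwa [smul_smul, Nat.cast_add, Nat.cast_one, one_div_mul_cancel hn.ne', one_smul] at h₂

theorem tendsto_zero_of_le_smul_mulOneSubPow [HasSolidNorm A] (h : IsCentralNormed A) {x : A}
    (hx₀ : 0 ≤ x) (hx : ‖x‖ ≤ 1) (c : ℝ) {w : ℕ → A} (hw₀ : ∀ n, 0 ≤ w n)
    (hw : ∀ n, w n ≤ c • mulOneSubPow x x n) : Tendsto w atTop (𝓝 0) := by
  have hlim := (tendsto_one_div_add_atTop_nhds_zero_nat (𝕜 := ℝ)).const_mul ‖c‖
  rw [mul_zero] at hlim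
  refine squeeze_zero_norm (fun n => ?_) hlim
  refine (norm_le_norm_of_nonneg_of_le (hw₀ n) (hw n)).trans ?_
  rw [norm_smul]
  exact mul_le_mul_of_nonneg_left (h.norm_mulOneSubPow_self_le hx₀ hx n) (norm_nonneg c)

/-- As `0 ≤ u ≤ z`, the error factor `1 - (z + u) / 2` lies between `0` and `1 - z / 2`, so the
error is at most `z (1 - z / 2) ^ n`. -/
theorem absApprox_bounds [IsScalarTower ℝ A A] [SMulCommClass ℝ A A] [HasSolidNorm A]
    (h : IsCentralNormed A) {z : A} (hz₀ : 0 ≤ z) (hz : ‖z‖ ≤ 1) (n : ℕ) :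
    0 ≤ absApprox z n ∧ 0 ≤ z - absApprox z n ∧
      z - absApprox z n ≤ mulOneSubPow ((1 / 2 : ℝ) • z) z n := by
  have half_nonneg : (0 : ℝ) ≤ 1 / 2 := by norm_num
  induction n with
  | zero => simpa [absApprox, mulOneSubPow] using hz₀
  | succ n ih =>
    obtain ⟨hu, hw, hwp⟩ := ih
    set u := absApprox z n
    have hs : (1 / 2 : ℝ) • z ≤ (1 / 2 : ℝ) • (z + u) :=
      smul_le_smul_of_nonneg_left (le_add_of_nonneg_right hu) half_nonneg
    have hs₀ : 0 ≤ (1 / 2 : ℝ) • (z + u) := smul_nonneg half_nonneg (add_nonneg hz₀ hu)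
    have hs₁ : (1 / 2 : ℝ) • (z + u) ≤ z := by
      refine (smul_le_smul_of_nonneg_left (add_le_add_right (sub_nonneg.1 hw) z)
        half_nonneg).trans_eq ?_
      rw [← two_smul ℝ z, smul_smul]
      norm_num
    have hw' : z - absApprox z (n + 1) ≤ z - u := by
      rw [sub_absApprox_succ]
      exact sub_le_self _ (h.mul_nonneg _ _ hw hs₀)
    have hwz : z - u ≤ z := sub_le_self _ hu
    have hhalf : ‖(1 / 2 : ℝ) • z‖ ≤ 1 := by
      rw [norm_smul]
      norm_num
      linarith
    refine ⟨?_, ?_, ?_⟩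
    · simpa using hw'.trans hwz
    · rw [sub_absApprox_succ]
      exact sub_nonneg.2 (h.mul_le_self hw ((norm_le_norm_of_nonneg_of_le hs₀ hs₁).trans hz))
    · rw [sub_absApprox_succ, mulOneSubPow.eq_2]
      refine (sub_le_sub_left (h.mul_le_mul_left hw hs) _).trans ?_
      have := sub_nonneg.2 (h.mul_le_self (sub_nonneg.2 hwp) hhalf)
      rw [sub_mul] at this
      refine sub_nonneg.1 (this.trans_eq ?_)
      abel

theorem tendsto_absApprox [IsScalarTower ℝ A A] [SMulCommClass ℝ A A] [HasSolidNorm A]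
    (h : IsCentralNormed A) {z : A} (hz₀ : 0 ≤ z) (hz : ‖z‖ ≤ 1) :
    Tendsto (absApprox z) atTop (𝓝 z) := by
  have hhalf : ‖(1 / 2 : ℝ) • z‖ ≤ 1 := by
    rw [norm_smul]
    norm_num
    linarith
  -- The constant is `2` because `z = 2 • (z / 2)`.
  have hlim := h.tendsto_zero_of_le_smul_mulOneSubPow (smul_nonneg (by norm_num) hz₀) hhalf 2
    (fun n => (h.absApprox_bounds hz₀ hz n).2.1) (fun n => by
      refine (h.absApprox_bounds hz₀ hz n).2.2.trans_eq ?_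
      rw [← mulOneSubPow_smul, smul_smul]
      norm_num)
  simpa using (tendsto_const_nhds (x := z)).sub hlim

variable [IsScalarTower ℝ A A] [HasSolidNorm A]

theorem mem_of_nonneg_of_le (h : IsCentralNormed A) {J : Submodule ℝ A}
    (hJc : IsClosed (J : Set A)) (hJ : IsAlgebraicIdeal J) {x y : A} (hx : x ∈ J) (hy₀ : 0 ≤ y)
    (hyx : y ≤ x) : y ∈ J := by
  rcases eq_or_ne x 0 with rfl | hx₀
  · rwa [le_antisymm hyx hy₀]
  have hpos : 0 < ‖x‖ := norm_pos_iff.2 hx₀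
  set v := ‖x‖⁻¹ • x
  have hv : v ∈ J := J.smul_mem _ hx
  have hv₀ : 0 ≤ v := smul_nonneg (inv_pos.2 hpos).le (hy₀.trans hyx)
  have hv₁ : ‖v‖ ≤ 1 := by
    rw [norm_smul, norm_inv, norm_norm, inv_mul_cancel₀ hpos.ne']
  have hvx : ‖x‖ • v = x := smul_inv_smul₀ hpos.ne' x
  have hlim := h.tendsto_zero_of_le_smul_mulOneSubPow hv₀ hv₁ ‖x‖
    (fun n => h.mulOneSubPow_nonneg hv₁ hy₀ n) (fun n => by
      rw [← mulOneSubPow_smul, hvx]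
      exact h.mulOneSubPow_mono hv₁ hyx n)
  have hlim' := (tendsto_const_nhds (x := y)).sub hlim
  rw [sub_zero] at hlim'
  refine hJc.mem_of_tendsto hlim' (Eventually.of_forall fun n => ?_)
  -- The differences `y - y (1 - v) ^ n` lie in `J`, as each step adds a multiple of `v`.
  induction n with
  | zero => simp [mulOneSubPow]
  | succ n ih =>
    have h₁ := J.add_mem ih (hJ (mulOneSubPow v y n) v hv).1
    rwa [sub_add] at h₁

variable [SMulCommClass ℝ A A]

theorem abs_mem (h : IsCentralNormed A) {Y : NonUnitalSubalgebra ℝ A} (hY : IsClosed (Y : Set A))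
    {x : A} (hx : x ∈ Y) : |x| ∈ Y := by
  rcases eq_or_ne x 0 with rfl | hx₀
  · simp
  have hpos : 0 < ‖x‖ := norm_pos_iff.2 hx₀
  have hy : ‖x‖⁻¹ • x ∈ Y := SMulMemClass.smul_mem _ hx
  have hnorm : ‖|‖x‖⁻¹ • x|‖ ≤ 1 := by
    rw [norm_abs_eq_norm, norm_smul, norm_inv, norm_norm, inv_mul_cancel₀ hpos.ne']
  have hmem : |‖x‖⁻¹ • x| ∈ Y :=
    hY.mem_of_tendsto (h.tendsto_absApprox (abs_nonneg _) hnorm) (Eventually.of_forall fun n => by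
      -- The iterates depend only on the square, so those for `|x|` are those for `x`.
      rw [absApprox_congr (h.abs_mul_abs_self _)]
      exact absApprox_mem hy n)
  rw [abs_smul_of_pos (inv_pos.2 hpos)] at hmem
  simpa [smul_smul, hpos.ne'] using SMulMemClass.smul_mem ‖x‖ hmem

theorem isSublattice (h : IsCentralNormed A) {Y : NonUnitalSubalgebra ℝ A}
    (hY : IsClosed (Y : Set A)) : IsSublattice (Y : Set A) := by
  have hsup : ∀ a ∈ Y, ∀ b ∈ Y, a ⊔ b ∈ Y := fun a ha b hb => by
    have h₁ : a ⊔ b = (1 / 2 : ℝ) • ((2 : ℕ) • (a ⊔ b)) := by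
      rw [← Nat.cast_smul_eq_nsmul ℝ, smul_smul]
      norm_num
    rw [h₁, two_nsmul_sup_eq_add_add_abs_sub]
    exact SMulMemClass.smul_mem _ (Y.add_mem (Y.add_mem ha hb) (h.abs_mem hY (Y.sub_mem hb ha)))
  refine ⟨fun a ha b hb => hsup a ha b hb, fun a ha b hb => ?_⟩
  have h₁ := Y.neg_mem (hsup (-a) (Y.neg_mem ha) (-b) (Y.neg_mem hb))
  rwa [neg_sup, neg_neg, neg_neg] at h₁

theorem isOrderIdeal_of_isAlgebraicIdeal (h : IsCentralNormed A) {J : Submodule ℝ A}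
    (hJc : IsClosed (J : Set A)) (hJ : IsAlgebraicIdeal J) : IsOrderIdeal J := by
  intro x hx y hyx
  -- A closed algebraic ideal is in particular a closed subalgebra.
  have habs : |x| ∈ J :=
    h.abs_mem (Y := { J with mul_mem' := fun {a b} _ hb => (hJ a b hb).1 }) hJc hx
  rw [← posPart_sub_negPart y]
  exact J.sub_mem
    (h.mem_of_nonneg_of_le hJc hJ habs (posPart_nonneg y)
      ((sup_le (le_abs_self y) (abs_nonneg y)).trans hyx))
    (h.mem_of_nonneg_of_le hJc hJ habs (negPart_nonneg y)
      ((sup_le (neg_le_abs y) (abs_nonneg y)).trans hyx))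

end IsCentralNormed

/-! ### Centrality and the norm bound from the net -/

variable [IsOrderedModule ℝ A] [HasSolidNorm A]

/-- For a norming positive `φ`, pass to the limit in `φ (e i * z) ≤ c * φ (e i)`. -/
theorem IsApproximateOrderUnit.norm_le_of_mul_le {ι : Type*} [Preorder ι] [IsDirectedOrder ι]
    [Nonempty ι] {e : ι → A} (hu : IsApproximateOrderUnit e) (hi : IsApproximateIdentity e)
    {z : A} (hz : 0 ≤ z) {c : ℝ} (hc : 0 ≤ c) (h : ∀ b : A, 0 ≤ b → b * z ≤ c • b) :
    ‖z‖ ≤ c := by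
  obtain ⟨φ, hφ, hφ₁, hφz⟩ := exists_positive_dual_eq_norm_posPart z
  rw [posPart_of_nonneg hz] at hφz
  rw [← hφz]
  refine (le_of_tendsto_of_tendsto ((φ.continuous.tendsto z).comp (hi.tendsto_left z))
    ((hu.tendsto_norm φ hφ).const_mul c) (Eventually.of_forall fun i => ?_)).trans
      (mul_le_of_le_one_right hc hφ₁)
  have h₁ := hφ _ (sub_nonneg.2 (h _ (hu.nonneg i)))
  rw [map_sub, map_smul, smul_eq_mul] at h₁
  exact sub_nonneg.1 h₁

variable [IsScalarTower ℝ A A] [SMulCommClass ℝ A A]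

theorem IsApproximateOrderUnit.mul_le_norm_smul {ι : Type*} [Preorder ι] [IsDirectedOrder ι]
    [Nonempty ι] {e : ι → A} (hu : IsApproximateOrderUnit e) (hi : IsApproximateIdentity e)
    (hmul : ∀ a b : A, 0 ≤ a → 0 ≤ b → 0 ≤ a * b) (a : A) {b : A} (hb : 0 ≤ b) :
    a * b ≤ ‖a‖ • b ∧ b * a ≤ ‖a‖ • b := by
  constructor
  all_goals refine le_of_forall_positive_dual fun φ hφ => ?_
  · let ψ : StrongDual ℝ A := φ.comp ((ContinuousLinearMap.mul ℝ A).flip b)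
    have h := tendsto_nhds_unique (hu.tendsto_norm ψ fun x hx => hφ _ (hmul _ _ hx hb))
      ((φ.continuous.tendsto b).comp (hi.tendsto_left b))
    have h' := (le_abs_self _).trans (ψ.le_opNorm a)
    rw [h] at h'
    simpa [ψ, mul_comm] using h'
  · let ψ : StrongDual ℝ A := φ.comp (ContinuousLinearMap.mul ℝ A b)
    have h := tendsto_nhds_unique (hu.tendsto_norm ψ fun x hx => hφ _ (hmul _ _ hb hx))
      ((φ.continuous.tendsto b).comp (hi.tendsto_right b))
    have h' := (le_abs_self _).trans (ψ.le_opNorm a)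
    rw [h] at h'
    simpa [ψ, mul_comm] using h'

theorem IsAMAlgebra.isCentralNormed (hA : IsAMAlgebra A)
    (hmul : ∀ a b : A, 0 ≤ a → 0 ≤ b → 0 ≤ a * b) : IsCentralNormed A := by
  obtain ⟨ι, _, _, _, e, hu, hi⟩ := hA
  exact ⟨hmul, fun a b hb => (hu.mul_le_norm_smul hi hmul a hb).1,
    fun a b hb => (hu.mul_le_norm_smul hi hmul a hb).2,
    fun z c hz hc h => hu.norm_le_of_mul_le hi hz hc h⟩

end LatticeAlgebra

theorem proposition4p2 {A : Type u}
    [NonUnitalNormedRing A] [NormedSpace ℝ A] [IsScalarTower ℝ A A] [SMulCommClass ℝ A A]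
    [CompleteSpace A]
    [Lattice A] [IsOrderedAddMonoid A] [IsOrderedModule ℝ A] [HasSolidNorm A]
    (mul_nonneg_A : ∀ a b : A, 0 ≤ a → 0 ≤ b → 0 ≤ a * b)
    (hA : IsAMAlgebra.{u, v} A) :
    (∀ Y : NonUnitalSubalgebra ℝ A, IsClosed (Y : Set A) → IsSublattice (Y : Set A)) ∧
    (∀ J : Submodule ℝ A, IsClosed (J : Set A) → (IsAlgebraicIdeal J ↔ IsOrderIdeal J)) := by
  have h := hA.isCentralNormed mul_nonneg_A
  exact ⟨fun Y hY => h.isSublattice hY, fun J hJ =>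
    ⟨h.isOrderIdeal_of_isAlgebraicIdeal hJ, h.isAlgebraicIdeal_of_isOrderIdeal⟩⟩
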